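/- Let $X$ be a separable Banach space over $\mathbb K=\mathbb R$ or $\mathbb K=\mathbb C$, and let $X^*$ be its space of bounded linear functionals. The following assertions are equivalent. (i) Every linear subspace $F\subset X^*$ (not assumed norm-closed) that is dense in $X^*$ for the weak-star topology $\sigma(X^*,X)$ is $w^*$-sequentially dense in $X^*$; that is, for every $g\in X^*$ there is a sequence $(f_n)_{n\in\mathbb N}$ in $F$ such that $\lim_{n\to\infty} f_n(x)=g(x)$ for all $x\in X$. (ii) $X$ is quasireflexive; that is, the canonical image of $X$ in its second dual $X^{**}$ has finite codimension: $\dim (X^{**}/X)<\infty$. -/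

import Mathlib

open Filter Topology

set_option maxSynthPendingDepth 3 in
/-- A normed space `X` is quasireflexive if its canonical image in the second dual
has finite codimension. -/
def IsQuasireflexive (𝕜 : Type*) [RCLike 𝕜] (X : Type*) [NormedAddCommGroup X]
    [NormedSpace 𝕜 X] : Prop :=
  FiniteDimensional 𝕜
    (StrongDual 𝕜 (StrongDual 𝕜 X) ⧸ (NormedSpace.inclusionInDoubleDual 𝕜 X).range)

/-- A set `F` of continuous functionals on `X` is weak-star sequentially dense if every
continuous functional is the pointwise limit of a sequence of elements of `F`. -/
def IsWeakStarSeqDense (𝕜 : Type*) [RCLike 𝕜] (X : Type*) [NormedAddCommGroup X]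
    [NormedSpace 𝕜 X] (F : Set (WeakDual 𝕜 X)) : Prop :=
  ∀ g : WeakDual 𝕜 X, ∃ f : ℕ → WeakDual 𝕜 X,
    (∀ n, f n ∈ F) ∧ ∀ x : X, Tendsto (fun n => f n x) atTop (𝓝 (g x))

/-! ### Helly's moment theorem and recursive choice. -/

section Helly

set_option maxSynthPendingDepth 3

variable {𝕜 E : Type*} [RCLike 𝕜] [NormedAddCommGroup E] [NormedSpace 𝕜 E]

/-! A weak-star dense `F` is total. If `X` is quasireflexive, the image of `X` in `F*` has finite
codimension, since `F*` is a quotient of `X**`; hence it is closed and `X → F*` is bounded below.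
Each `g` then factors through `F*` as some `Ψ` in `F**`, and Helly's theorem in `F` gives a bounded
sequence agreeing with `g` at more and more points of a dense sequence.

If `X` is not quasireflexive, one builds unit vectors `y n`, bidual vectors `φ n` of norm at most
`1/(n+1)`, and a total span `F` of functionals `h m` with `h m (y n) = φ n (h m)` for all `m`, `n`.
Thus `|f (y n)| ≤ ‖f‖/(n+1)` on `F`. Were `F` sequentially dense, uniform boundedness would make
`(n+1) • y n` weakly bounded, hence norm bounded, which is absurd. The core is `exists_admissible`.
-/

theorem finiteDimensional_quotient_ker_pi {V : Type*} [AddCommGroup V] [Module 𝕜 V]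
    {s : Set (V →ₗ[𝕜] 𝕜)} (hs : s.Finite) :
    FiniteDimensional 𝕜 (V ⧸ (LinearMap.pi fun θ : s => (θ : V →ₗ[𝕜] 𝕜)).ker) := by
  have := hs.to_subtype
  exact (LinearMap.quotKerEquivRange
    (LinearMap.pi fun θ : s => (θ : V →ₗ[𝕜] 𝕜))).symm.finiteDimensional

/-- **Helly's theorem** on moment problems: a functional on the dual can be interpolated at
finitely many points by a vector of almost the same norm. -/
theorem exists_norm_le_forall_mem_apply_eq {s : Set (StrongDual 𝕜 E)} (hs : s.Finite)
    (Ψ : StrongDual 𝕜 (StrongDual 𝕜 E)) :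
    ∃ u : E, ‖u‖ ≤ ‖Ψ‖ + 1 ∧ ∀ θ ∈ s, θ u = Ψ θ := by
  have := hs.to_subtype
  set T : E →L[𝕜] (s → 𝕜) := ContinuousLinearMap.pi fun θ : s => (θ : StrongDual 𝕜 E)
  set N : Submodule 𝕜 E := T.toLinearMap.ker
  have hNc : IsClosed (N : Set E) := T.isClosed_ker
  have hfd : FiniteDimensional 𝕜 (E ⧸ N) :=
    (LinearMap.quotKerEquivRange T.toLinearMap).symm.finiteDimensional
  let π : E →L[𝕜] E ⧸ N := N.mkQL
  have hπ (x : E) : ‖π x‖ ≤ ‖x‖ := Submodule.Quotient.norm_mk_le N x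
  let R : StrongDual 𝕜 (E ⧸ N) →ₗ[𝕜] StrongDual 𝕜 E :=
    { toFun := fun η => η.comp π
      map_add' := fun _ _ => rfl
      map_smul' := fun _ _ => rfl }
  -- The finite-dimensional quotient `E ⧸ N` is reflexive, so `Ψ` restricted to its dual is
  -- evaluation at some `e`.
  obtain ⟨e, he⟩ := (Module.evalEquiv 𝕜 (E ⧸ N)).surjective
    (Ψ.toLinearMap ∘ₗ R ∘ₗ (LinearMap.toContinuousLinearMap
      (𝕜 := 𝕜) (E := E ⧸ N) (F' := 𝕜)).toLinearMap)
  have hη (η : StrongDual 𝕜 (E ⧸ N)) : η e = Ψ (η.comp π) := by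
    have := DFunLike.congr_fun he η.toLinearMap
    exact this.trans rfl
  have hnorm : ‖e‖ ≤ ‖Ψ‖ := by
    refine NormedSpace.norm_le_dual_bound 𝕜 e (norm_nonneg _) fun η => ?_
    rw [hη]
    refine (Ψ.le_opNorm _).trans (mul_le_mul_of_nonneg_left ?_ (norm_nonneg _))
    refine ContinuousLinearMap.opNorm_le_bound _ (norm_nonneg _) fun x => ?_
    exact (η.le_opNorm _).trans (mul_le_mul_of_nonneg_left (hπ x) (norm_nonneg _))
  obtain ⟨u, hu, hun⟩ := Submodule.Quotient.norm_mk_lt e one_pos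
  refine ⟨u, by linarith, fun θ hθ => ?_⟩
  have hker : N ≤ θ.toLinearMap.ker := fun x hx => by
    have : T x = 0 := hx
    exact congr_fun this ⟨θ, hθ⟩
  let η : StrongDual 𝕜 (E ⧸ N) := LinearMap.toContinuousLinearMap (N.liftQ θ.toLinearMap hker)
  have hηπ : η.comp π = θ := by ext x; rfl
  have h1 := hη η
  rw [hηπ] at h1
  rw [← h1, ← hu]
  rfl

theorem exists_notMem_forall_mem_apply_eq_zero {V : Type*} [AddCommGroup V] [Module 𝕜 V]
    {M : Submodule 𝕜 V} (hM : ¬ FiniteDimensional 𝕜 (V ⧸ M))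
    {s : Set (V →ₗ[𝕜] 𝕜)} (hs : s.Finite) :
    ∃ v ∉ M, ∀ θ ∈ s, θ v = 0 := by
  by_contra! h
  refine hM ?_
  have : (LinearMap.pi fun θ : s => (θ : V →ₗ[𝕜] 𝕜)).ker.CoFG :=
    finiteDimensional_quotient_ker_pi hs
  refine Submodule.CoFG.of_le (S := (LinearMap.pi fun θ : s => (θ : V →ₗ[𝕜] 𝕜)).ker)
    (fun v hv => ?_) ‹_›
  by_contra hvM
  obtain ⟨θ, hθ, h0⟩ := h v hvM
  exact h0 (congr_fun (LinearMap.mem_ker.1 hv) ⟨θ, hθ⟩)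

theorem exists_strongDual_eq_one_of_notMem {M : Submodule 𝕜 E} (hM : IsClosed (M : Set E))
    {v : E} (hv : v ∉ M) : ∃ ζ : StrongDual 𝕜 E, (∀ m ∈ M, ζ m = 0) ∧ ζ v = 1 := by
  have hv' : (M.mkQ v) ≠ 0 := by simpa using hv
  obtain ⟨η, hη⟩ := SeparatingDual.exists_eq_one (R := 𝕜) hv'
  refine ⟨η.comp M.mkQL, fun m hm => ?_, hη⟩
  have : M.mkQ m = 0 := by simpa using hm
  change η (M.mkQ m) = 0
  rw [this, map_zero]

/-- Recursive construction of a sequence whose `n`-th term is chosen depending on all the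
previous ones. -/
theorem exists_seq_forall_of_prefix {α : Type*} [Nonempty α] (Q : ℕ → (ℕ → α) → α → Prop)
    (congr : ∀ n s s' a, (∀ i < n, s i = s' i) → Q n s a → Q n s' a)
    (step : ∀ n s, (∀ m < n, Q m s (s m)) → ∃ a, Q n s a) :
    ∃ s : ℕ → α, ∀ n, Q n s (s n) := by
  classical
  inhabit α
  choose! F hF using step
  let ext (n : ℕ) (f : ∀ m < n, α) : ℕ → α := fun i => if h : i < n then f i h else default
  let s : ℕ → α := fun n => Nat.strongRec (motive := fun _ => α) (fun n f => F n (ext n f)) n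
  have hs (n : ℕ) : s n = F n (ext n fun m _ => s m) := by
    simp only [s]
    rw [Nat.strongRec_eq]
  have hext (n i : ℕ) (hi : i < n) : (ext n fun m _ => s m) i = s i := by simp [ext, hi]
  refine ⟨s, fun n => ?_⟩
  induction n using Nat.strong_induction_on with
  | _ n ih =>
    refine congr n _ s _ (hext n) ?_
    rw [hs n]
    refine hF n _ fun m hm => ?_
    rw [hext n m hm]
    exact congr m s _ _ (fun i hi => (hext n i (hi.trans hm)).symm) (ih m hm)

end Helly

/-! ### Total subspaces, and norming ones in the quasireflexive case. -/

section Interpolation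

set_option maxSynthPendingDepth 3

variable {𝕜 X : Type*} [RCLike 𝕜] [NormedAddCommGroup X] [NormedSpace 𝕜 X]

/-- Totality embeds the finite-dimensional span of `s` into the algebraic dual of `F`; dually, `F`
maps onto the dual of that span. -/
theorem exists_mem_forall_apply_eq_of_total {F : Submodule 𝕜 (StrongDual 𝕜 X)}
    (hF : ∀ x, (∀ f ∈ F, f x = 0) → x = 0) (s : Finset X) (g : StrongDual 𝕜 X) :
    ∃ f ∈ F, ∀ x ∈ s, f x = g x := by
  let V : Submodule 𝕜 X := Submodule.span 𝕜 s
  let B : V →ₗ[𝕜] F →ₗ[𝕜] 𝕜 := LinearMap.mk₂ 𝕜 (fun v f => (f : StrongDual 𝕜 X) v)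
    (fun _ _ _ => by simp) (fun _ _ _ => by simp) (fun _ _ _ => by simp) (fun _ _ _ => by simp)
  have hB : Function.Injective B := by
    rw [injective_iff_map_eq_zero]
    intro v hv
    exact Subtype.ext (hF v fun f hf => DFunLike.congr_fun hv ⟨f, hf⟩)
  obtain ⟨f, hf⟩ := LinearMap.flip_surjective_iff₁.2 hB (g.toLinearMap ∘ₗ V.subtype)
  exact ⟨f, f.2, fun x hx => DFunLike.congr_fun hf ⟨x, Submodule.subset_span hx⟩⟩

theorem dense_map_toWeakDual_of_total {F : Submodule 𝕜 (StrongDual 𝕜 X)}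
    (hF : ∀ x, (∀ f ∈ F, f x = 0) → x = 0) :
    Dense ((F.map (StrongDual.toWeakDual (𝕜 := 𝕜) (E := X)).toLinearMap :
      Submodule 𝕜 (WeakDual 𝕜 X)) : Set (WeakDual 𝕜 X)) := by
  classical
  intro g
  choose f hfF hf using fun s : Finset X => exists_mem_forall_apply_eq_of_total hF s g.toStrongDual
  refine mem_closure_of_tendsto (f := fun s => StrongDual.toWeakDual (f s)) (b := atTop)
    (WeakBilin.tendsto_iff_forall_eval_tendsto _ ContinuousLinearMap.coe_injective |>.2 fun x => ?_)
    (Eventually.of_forall fun s => ⟨f s, hfF s, rfl⟩)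
  refine tendsto_const_nhds.congr' ?_
  filter_upwards [eventually_ge_atTop {x}] with s hs
  exact (hf s x (hs (Finset.mem_singleton_self x))).symm

theorem eq_zero_of_dense_of_forall_apply_eq_zero {F : Set (WeakDual 𝕜 X)} (hF : Dense F)
    {x : X} (hx : ∀ f ∈ F, f x = 0) : x = 0 := by
  refine SeparatingDual.eq_zero_of_forall_dual_eq_zero (R := 𝕜) fun g => ?_
  exact hF.induction (P := fun f : WeakDual 𝕜 X => f x = 0) hx
    (isClosed_eq (WeakDual.eval_continuous x) continuous_const) (StrongDual.toWeakDual g)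

theorem tendsto_apply_of_bounded_of_denseRange {ι : Type*} {u : ι → X} (hu : DenseRange u)
    {f : ℕ → StrongDual 𝕜 X} {g : StrongDual 𝕜 X} {C : ℝ} (hC : ∀ n, ‖f n‖ ≤ C)
    (hf : ∀ i, Tendsto (fun n => f n (u i)) atTop (𝓝 (g (u i)))) (x : X) :
    Tendsto (fun n => f n x) atTop (𝓝 (g x)) := by
  have hC0 : 0 ≤ C := (norm_nonneg _).trans (hC 0)
  rw [Metric.tendsto_atTop]
  intro ε hε
  have hK : 0 < C + ‖g‖ + 1 := by positivity
  obtain ⟨i, hi⟩ := hu.exists_dist_lt x (div_pos (half_pos hε) hK)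
  obtain ⟨N, hN⟩ := Metric.tendsto_atTop.1 (hf i) (ε / 2) (half_pos hε)
  refine ⟨N, fun n hn => ?_⟩
  have h1 := hN n hn
  rw [dist_eq_norm] at h1 hi ⊢
  have h2 : f n x - g x = (f n - g) (x - u i) + (f n (u i) - g (u i)) := by
    simp only [sub_apply, map_sub]; ring
  have h3 : ‖(f n - g) (x - u i)‖ ≤ (C + ‖g‖ + 1) * ‖x - u i‖ := by
    refine ((f n - g).le_opNorm _).trans (mul_le_mul_of_nonneg_right ?_ (norm_nonneg _))
    have := norm_sub_le (f n) g
    linarith [hC n]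
  have h4 : (C + ‖g‖ + 1) * ‖x - u i‖ < ε / 2 := by
    rw [lt_div_iff₀ hK] at hi; linarith
  rw [h2]
  exact (norm_add_le _ _).trans_lt (by linarith)

variable (𝕜) in
/-- Evaluation of the functionals of a subspace of the dual at the points of the space. -/
noncomputable def evalOn (F : Submodule 𝕜 (StrongDual 𝕜 X)) : X →L[𝕜] StrongDual 𝕜 F :=
  ((ContinuousLinearMap.compL 𝕜 F (StrongDual 𝕜 X) 𝕜).flip F.subtypeL).comp
    (NormedSpace.inclusionInDoubleDual 𝕜 X)

/-- Total subspaces of the dual of a quasireflexive space are norming. -/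
theorem IsQuasireflexive.exists_antilipschitz_evalOn [CompleteSpace X] (h : IsQuasireflexive 𝕜 X)
    {F : Submodule 𝕜 (StrongDual 𝕜 X)} (hF : ∀ x, (∀ f ∈ F, f x = 0) → x = 0) :
    ∃ K, AntilipschitzWith K (evalOn 𝕜 F) := by
  have hinj : Function.Injective (evalOn 𝕜 F) := by
    rw [injective_iff_map_eq_zero]
    exact fun x hx => hF x fun f hf => DFunLike.congr_fun hx ⟨f, hf⟩
  refine (evalOn 𝕜 F).antilipschitz_of_injective_of_isClosed_range hinj ?_
  let ρ : StrongDual 𝕜 (StrongDual 𝕜 X) →L[𝕜] StrongDual 𝕜 F :=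
    (ContinuousLinearMap.compL 𝕜 F (StrongDual 𝕜 X) 𝕜).flip F.subtypeL
  have hρ : Function.Surjective ρ := fun ψ => by
    obtain ⟨φ, hφ, -⟩ := exists_extension_norm_eq F ψ
    exact ⟨φ, ContinuousLinearMap.ext hφ⟩
  -- Restriction `ρ` carries `X` onto the range of `evalOn`, so it induces a surjection from `X**/X`
  -- onto the cokernel of `evalOn`.
  have hle : (NormedSpace.inclusionInDoubleDual 𝕜 X).range ≤
      (evalOn 𝕜 F).range.comap ρ.toLinearMap := by
    rintro _ ⟨x, rfl⟩
    exact ⟨x, rfl⟩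
  have hfin : FiniteDimensional 𝕜 (StrongDual 𝕜 F ⧸ (evalOn 𝕜 F).range) := by
    unfold IsQuasireflexive at h
    refine Module.Finite.of_surjective (Submodule.mapQ _ _ ρ.toLinearMap hle) ?_
    rw [← LinearMap.range_eq_top, Submodule.range_mapQ, LinearMap.range_eq_top.2 hρ]
    simp
  obtain ⟨G, hG⟩ := (evalOn 𝕜 F).range.exists_isCompl
  have hGfin : FiniteDimensional 𝕜 G :=
    (Submodule.quotientEquivOfIsCompl _ _ hG).finiteDimensional
  exact ContinuousLinearMap.closed_complemented_range_of_isCompl_of_ker_eq_bot _ G hG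
    G.closed_of_finiteDimensional (LinearMap.ker_eq_bot.2 hinj)

theorem exists_comp_eq_of_antilipschitz {Y : Type*} [NormedAddCommGroup Y] [NormedSpace 𝕜 Y]
    {T : X →L[𝕜] Y} {K : NNReal} (hK : AntilipschitzWith K T) (g : StrongDual 𝕜 X) :
    ∃ Ψ : StrongDual 𝕜 Y, ∀ x, Ψ (T x) = g x := by
  let e : X ≃ₗ[𝕜] T.range := LinearEquiv.ofInjective T.toLinearMap hK.injective
  have he (x : X) : (e x : Y) = T x := rfl
  have hb (y : T.range) : ‖e.symm y‖ ≤ K * ‖y‖ := by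
    have := hK.le_mul_dist (e.symm y) 0
    rw [map_zero, dist_zero_right, dist_zero_right, ← he, e.apply_symm_apply] at this
    exact this
  let ψ : StrongDual 𝕜 T.range :=
    (g.toLinearMap ∘ₗ e.symm.toLinearMap).mkContinuous (‖g‖ * K) fun y => by
      rw [mul_assoc]
      exact (g.le_opNorm (e.symm y)).trans (mul_le_mul_of_nonneg_left (hb y) (norm_nonneg _))
  obtain ⟨Ψ, hΨ, -⟩ := exists_extension_norm_eq _ ψ
  refine ⟨Ψ, fun x => ?_⟩
  rw [← he, hΨ]
  change g (e.symm (e x)) = g x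
  rw [e.symm_apply_apply]

theorem exists_bounded_seq_of_antilipschitz_evalOn {F : Submodule 𝕜 (StrongDual 𝕜 X)}
    {K : NNReal} (hK : AntilipschitzWith K (evalOn 𝕜 F)) (g : StrongDual 𝕜 X) (u : ℕ → X) :
    ∃ C, ∃ f : ℕ → StrongDual 𝕜 X, (∀ n, f n ∈ F) ∧ (∀ n, ‖f n‖ ≤ C) ∧
      ∀ n, ∀ i ≤ n, f n (u i) = g (u i) := by
  obtain ⟨Ψ, hΨx⟩ := exists_comp_eq_of_antilipschitz hK g
  choose f hfn hf using fun n : ℕ => exists_norm_le_forall_mem_apply_eq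
    (s := (fun i => evalOn 𝕜 F (u i)) '' Set.Iic n) ((Set.finite_Iic n).image _) Ψ
  refine ⟨‖Ψ‖ + 1, fun n => f n, fun n => (f n).2, hfn, fun n i hi => ?_⟩
  rw [← hΨx, ← hf n _ ⟨i, hi, rfl⟩]
  rfl

end Interpolation

/-! ### A total nonnorming subspace when quasireflexivity fails. -/

section Nonnorming

set_option maxSynthPendingDepth 3

/-- The data chosen at each step of the construction of a total nonnorming subspace: a bidual
vector `bidual`, a functional `separator` on the bidual, a point, and a functional. -/
structure NonnormingDatum (𝕜 X : Type*) [RCLike 𝕜] [NormedAddCommGroup X] [NormedSpace 𝕜 X] where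
  bidual : StrongDual 𝕜 (StrongDual 𝕜 X)
  separator : StrongDual 𝕜 (StrongDual 𝕜 (StrongDual 𝕜 X))
  point : X
  functional : StrongDual 𝕜 X

namespace NonnormingDatum

variable {𝕜 X : Type*} [RCLike 𝕜] [NormedAddCommGroup X] [NormedSpace 𝕜 X]

instance : Nonempty (NonnormingDatum 𝕜 X) := ⟨⟨0, 0, 0, 0⟩⟩

/-- The functional on the bidual, vanishing on the space, that prescribes the correction to be
applied to the functional `f`. -/
noncomputable def correction (s : ℕ → NonnormingDatum 𝕜 X) (f : StrongDual 𝕜 X) (k : ℕ) :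
    StrongDual 𝕜 (StrongDual 𝕜 (StrongDual 𝕜 X)) :=
  ∑ i ∈ Finset.range k, (f (s i).point - (s i).bidual f) • (s i).separator

/-- Compatibility of a datum with the `n` preceding ones, relative to a sequence `d` of
functionals and a sequence `x` of points. -/
structure Admissible (d : ℕ → StrongDual 𝕜 X) (x : ℕ → X) (n : ℕ)
    (s : ℕ → NonnormingDatum 𝕜 X) (a : NonnormingDatum 𝕜 X) : Prop where
  norm_bidual : ‖a.bidual‖ * (n + 1) ≤ 1
  separator_inclusion : ∀ z, a.separator (NormedSpace.inclusionInDoubleDual 𝕜 X z) = 0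
  separator_self : a.separator a.bidual = 1
  separator_prev : ∀ i < n, a.separator (s i).bidual = 0
  prev_separator : ∀ i < n, (s i).separator a.bidual = 0
  norm_point : ‖a.point‖ = 1
  apply_point : ∀ k ≤ n, d k a.point = 0
  bidual_apply : ∀ k ≤ n, a.bidual (d k) = 0
  prev_functional_point : ∀ i < n, (s i).functional a.point = 0
  bidual_prev_functional : ∀ i < n, a.bidual (s i).functional = 0
  functional_prev : ∀ i < n, a.functional (s i).point = (s i).bidual a.functional
  functional_self : a.functional a.point = a.bidual a.functional
  functional_apply : ∀ i ≤ n, a.functional (x i) = d n.unpair.1 (x i)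
  norm_functional_sub :
    ‖a.functional - d n.unpair.1‖ ≤ ‖correction s (d n.unpair.1) n.unpair.1‖ + 1

theorem Admissible.congr {d : ℕ → StrongDual 𝕜 X} {x : ℕ → X} {n : ℕ}
    {s s' : ℕ → NonnormingDatum 𝕜 X} {a : NonnormingDatum 𝕜 X} (hs : ∀ i < n, s i = s' i)
    (h : Admissible d x n s a) : Admissible d x n s' a where
  norm_bidual := h.norm_bidual
  separator_inclusion := h.separator_inclusion
  separator_self := h.separator_self
  separator_prev i hi := hs i hi ▸ h.separator_prev i hi
  prev_separator i hi := hs i hi ▸ h.prev_separator i hi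
  norm_point := h.norm_point
  apply_point := h.apply_point
  bidual_apply := h.bidual_apply
  prev_functional_point i hi := hs i hi ▸ h.prev_functional_point i hi
  bidual_prev_functional i hi := hs i hi ▸ h.bidual_prev_functional i hi
  functional_prev i hi := hs i hi ▸ h.functional_prev i hi
  functional_self := h.functional_self
  functional_apply := h.functional_apply
  norm_functional_sub := by
    have : correction s (d n.unpair.1) n.unpair.1 = correction s' (d n.unpair.1) n.unpair.1 :=
      Finset.sum_congr rfl fun i hi => by
        rw [hs i ((Finset.mem_range.1 hi).trans_le n.unpair_left_le)]
    exact this ▸ h.norm_functional_sub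

theorem separator_bidual {d : ℕ → StrongDual 𝕜 X} {x : ℕ → X} {n : ℕ}
    {s : ℕ → NonnormingDatum 𝕜 X} (hs : ∀ m < n, Admissible d x m s (s m))
    {i j : ℕ} (hi : i < n) (hj : j < n) :
    (s i).separator (s j).bidual = if i = j then 1 else 0 := by
  rcases lt_trichotomy i j with h | rfl | h
  · rw [if_neg h.ne, (hs j hj).prev_separator i h]
  · rw [if_pos rfl, (hs i hi).separator_self]
  · rw [if_neg h.ne', (hs i hi).separator_prev j h]

theorem exists_admissible_bidual [CompleteSpace X] (hX : ¬ IsQuasireflexive 𝕜 X)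
    {d : ℕ → StrongDual 𝕜 X} {x : ℕ → X} {n : ℕ} {s : ℕ → NonnormingDatum 𝕜 X}
    (hs : ∀ m < n, Admissible d x m s (s m)) :
    ∃ (φ : StrongDual 𝕜 (StrongDual 𝕜 X)) (ζ : StrongDual 𝕜 (StrongDual 𝕜 (StrongDual 𝕜 X))),
      ‖φ‖ * (n + 1) ≤ 1 ∧ (∀ z, ζ (NormedSpace.inclusionInDoubleDual 𝕜 X z) = 0) ∧ ζ φ = 1 ∧
      (∀ i < n, ζ (s i).bidual = 0) ∧ (∀ i < n, (s i).separator φ = 0) ∧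
      (∀ k ≤ n, φ (d k) = 0) ∧ ∀ i < n, φ (s i).functional = 0 := by
  set M := (NormedSpace.inclusionInDoubleDual 𝕜 X).range
  have hM : IsClosed (M : Set (StrongDual 𝕜 (StrongDual 𝕜 X))) :=
    (NormedSpace.inclusionInDoubleDualLi (E := X) 𝕜).isometry.isClosedEmbedding.isClosed_range
  let ev (f : StrongDual 𝕜 X) : StrongDual 𝕜 (StrongDual 𝕜 X) →ₗ[𝕜] 𝕜 :=
    (NormedSpace.inclusionInDoubleDual 𝕜 (StrongDual 𝕜 X) f).toLinearMap
  obtain ⟨v, hvM, hv⟩ := exists_notMem_forall_mem_apply_eq_zero (M := M) hX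
    (s := ((fun i => (s i).separator.toLinearMap) '' Set.Iio n) ∪ ((fun k => ev (d k)) '' Set.Iic n)
      ∪ ((fun i => ev (s i).functional) '' Set.Iio n))
    ((((Set.finite_Iio n).image _).union ((Set.finite_Iic n).image _)).union
      ((Set.finite_Iio n).image _))
  obtain ⟨ζ, hζM, hζ⟩ := exists_strongDual_eq_one_of_notMem hM hvM
  have hv1 (i : ℕ) (hi : i < n) : (s i).separator v = 0 := hv _ (.inl (.inl ⟨i, hi, rfl⟩))
  have hv2 (k : ℕ) (hk : k ≤ n) : v (d k) = 0 := hv _ (.inl (.inr ⟨k, hk, rfl⟩))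
  have hv3 (i : ℕ) (hi : i < n) : v (s i).functional = 0 := hv _ (.inr ⟨i, hi, rfl⟩)
  -- Gram–Schmidt: biorthogonality of the earlier data kills the values at earlier bidual vectors,
  -- and `v` lies in the kernels of the earlier separators.
  let ζ' := ζ - ∑ i ∈ Finset.range n, ζ (s i).bidual • (s i).separator
  have hζ' (θ) : ζ' θ = ζ θ - ∑ i ∈ Finset.range n, ζ (s i).bidual * (s i).separator θ := by
    simp [ζ']
  have hζ'v : ζ' v = 1 := by
    rw [hζ', hζ, Finset.sum_eq_zero, sub_zero]
    intro i hi
    rw [hv1 i (Finset.mem_range.1 hi), mul_zero]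
  have hζ'J (z : X) : ζ' (NormedSpace.inclusionInDoubleDual 𝕜 X z) = 0 := by
    have hz : ζ (NormedSpace.inclusionInDoubleDual 𝕜 X z) = 0 := hζM _ ⟨z, rfl⟩
    rw [hζ', hz, Finset.sum_eq_zero, sub_zero]
    intro i hi
    rw [(hs i (Finset.mem_range.1 hi)).separator_inclusion, mul_zero]
  have hζ's (j : ℕ) (hj : j < n) : ζ' (s j).bidual = 0 := by
    rw [hζ', Finset.sum_eq_single_of_mem j (Finset.mem_range.2 hj), separator_bidual hs hj hj]
    · simp
    · intro i hi hij
      rw [separator_bidual hs (Finset.mem_range.1 hi) hj, if_neg hij, mul_zero]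
  let r : ℝ := (‖v‖ + 1) * (n + 1)
  have hr : 0 < r := by positivity
  have hr' : (r : 𝕜) ≠ 0 := by exact_mod_cast hr.ne'
  refine ⟨(r : 𝕜)⁻¹ • v, (r : 𝕜) • ζ', ?_, fun z => ?_, ?_, fun i hi => ?_, fun i hi => ?_,
    fun k hk => ?_, fun i hi => ?_⟩
  · rw [norm_smul, norm_inv, RCLike.norm_ofReal, abs_of_pos hr, mul_assoc, inv_mul_le_one₀ hr]
    exact mul_le_mul_of_nonneg_right (by linarith) (by positivity)
  · rw [smul_apply, hζ'J, smul_zero]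
  · rw [smul_apply, map_smul, hζ'v]
    simp [hr']
  · rw [smul_apply, hζ's i hi, smul_zero]
  · rw [map_smul, hv1 i hi, smul_zero]
  · rw [smul_apply, hv2 k hk, smul_zero]
  · rw [smul_apply, hv3 i hi, smul_zero]

theorem exists_norm_eq_one_forall_mem_apply_eq_zero (hX : ¬ FiniteDimensional 𝕜 X)
    {t : Set (StrongDual 𝕜 X)} (ht : t.Finite) : ∃ y : X, ‖y‖ = 1 ∧ ∀ f ∈ t, f y = 0 := by
  have hbot : ¬ FiniteDimensional 𝕜 (X ⧸ (⊥ : Submodule 𝕜 X)) := fun h =>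
    hX ((Submodule.quotEquivOfEqBot (⊥ : Submodule 𝕜 X) rfl).finiteDimensional)
  obtain ⟨v, hv0, hv⟩ := exists_notMem_forall_mem_apply_eq_zero hbot
    (s := (fun f : StrongDual 𝕜 X => f.toLinearMap) '' t) (ht.image _)
  refine ⟨((‖v‖ : 𝕜)⁻¹) • v, norm_smul_inv_norm (by simpa using hv0), fun f hf => ?_⟩
  have : f v = 0 := hv _ ⟨f, hf, rfl⟩
  rw [map_smul, this, smul_zero]

theorem not_finiteDimensional_of_not_isQuasireflexive (hX : ¬ IsQuasireflexive 𝕜 X) :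
    ¬ FiniteDimensional 𝕜 X := by
  intro h
  refine hX ?_
  have h1 : FiniteDimensional 𝕜 (StrongDual 𝕜 X) :=
    (LinearMap.toContinuousLinearMap (𝕜 := 𝕜) (E := X) (F' := 𝕜)).finiteDimensional
  have h2 : FiniteDimensional 𝕜 (StrongDual 𝕜 (StrongDual 𝕜 X)) :=
    (LinearMap.toContinuousLinearMap (𝕜 := 𝕜) (E := StrongDual 𝕜 X) (F' := 𝕜)).finiteDimensional
  unfold IsQuasireflexive
  infer_instance

/-- The new functional is `d k + u`, where `u` repairs the mismatch between `d k (y i)` and `φ i (d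
k)`. Both vanish for `i ≥ k`, so only `k` terms need repair and the bound on `‖u‖` depends on `k`,
not on `n`; totality of the span rests on this. -/
theorem exists_admissible [CompleteSpace X] (hX : ¬ IsQuasireflexive 𝕜 X)
    (d : ℕ → StrongDual 𝕜 X) (x : ℕ → X) (n : ℕ) (s : ℕ → NonnormingDatum 𝕜 X)
    (hs : ∀ m < n, Admissible d x m s (s m)) : ∃ a, Admissible d x n s a := by
  obtain ⟨φ, ζ, hφn, hζJ, hζφ, hζs, hsφ, hφd, hφs⟩ := exists_admissible_bidual hX hs
  obtain ⟨y, hy, hyt⟩ := exists_norm_eq_one_forall_mem_apply_eq_zero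
    (not_finiteDimensional_of_not_isQuasireflexive hX)
    (t := (d '' Set.Iic n) ∪ ((fun i => (s i).functional) '' Set.Iio n))
    (((Set.finite_Iic n).image _).union ((Set.finite_Iio n).image _))
  have hyd (k : ℕ) (hk : k ≤ n) : d k y = 0 := hyt _ (.inl ⟨k, hk, rfl⟩)
  have hys (i : ℕ) (hi : i < n) : (s i).functional y = 0 := hyt _ (.inr ⟨i, hi, rfl⟩)
  set k := n.unpair.1 with hk
  have hkn : k ≤ n := n.unpair_left_le
  set Ψ := correction s (d k) k with hΨ
  have hΨθ (θ) : Ψ θ = ∑ i ∈ Finset.range k,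
      (d k (s i).point - (s i).bidual (d k)) * (s i).separator θ := by
    simp [hΨ, correction]
  have hΨJ (z : X) : Ψ (NormedSpace.inclusionInDoubleDual 𝕜 X z) = 0 := by
    rw [hΨθ]
    refine Finset.sum_eq_zero fun i hi => ?_
    rw [(hs i ((Finset.mem_range.1 hi).trans_le hkn)).separator_inclusion, mul_zero]
  have hΨφ : Ψ φ = 0 := by
    rw [hΨθ]
    refine Finset.sum_eq_zero fun i hi => ?_
    rw [hsφ i ((Finset.mem_range.1 hi).trans_le hkn), mul_zero]
  have hΨs (i : ℕ) (hi : i < n) :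
      (s i).bidual (d k) + Ψ (s i).bidual = d k (s i).point := by
    by_cases hik : i < k
    · rw [hΨθ, Finset.sum_eq_single_of_mem i (Finset.mem_range.2 hik)]
      · rw [separator_bidual hs hi hi]
        simp
      · intro j hj hji
        rw [separator_bidual hs ((Finset.mem_range.1 hj).trans_le hkn) hi, if_neg hji, mul_zero]
    · rw [not_lt] at hik
      rw [hΨθ, Finset.sum_eq_zero, (hs i hi).bidual_apply k hik, (hs i hi).apply_point k hik,
        add_zero]
      intro j hj
      rw [(hs i hi).prev_separator j ((Finset.mem_range.1 hj).trans_le hik), mul_zero]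
  -- Helly's theorem in `X*`: since `Ψ` vanishes on `X`, `u` can vanish at all chosen points while
  -- having the prescribed values against the bidual vectors.
  obtain ⟨u, hu, hut⟩ := exists_norm_le_forall_mem_apply_eq
    (s := {φ, NormedSpace.inclusionInDoubleDual 𝕜 X y} ∪ ((fun i => (s i).bidual) '' Set.Iio n) ∪
      ((fun i => NormedSpace.inclusionInDoubleDual 𝕜 X (s i).point) '' Set.Iio n) ∪
      ((fun i => NormedSpace.inclusionInDoubleDual 𝕜 X (x i)) '' Set.Iic n))
    (((((Set.finite_singleton _).insert _).union ((Set.finite_Iio n).image _)).union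
      ((Set.finite_Iio n).image _)).union ((Set.finite_Iic n).image _)) Ψ
  have huφ : φ u = 0 := (hut φ (.inl (.inl (.inl (.inl rfl))))).trans hΨφ
  have huy : u y = 0 := (hut _ (.inl (.inl (.inl (.inr rfl))))).trans (hΨJ y)
  have hus (i : ℕ) (hi : i < n) : (s i).bidual u = Ψ (s i).bidual :=
    hut _ (.inl (.inl (.inr ⟨i, hi, rfl⟩)))
  have hup (i : ℕ) (hi : i < n) : u (s i).point = 0 :=
    (hut _ (.inl (.inr ⟨i, hi, rfl⟩))).trans (hΨJ _)
  have hux (i : ℕ) (hi : i ≤ n) : u (x i) = 0 := (hut _ (.inr ⟨i, hi, rfl⟩)).trans (hΨJ _)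
  exact ⟨⟨φ, ζ, y, d k + u⟩,
    { norm_bidual := hφn
      separator_inclusion := hζJ
      separator_self := hζφ
      separator_prev := hζs
      prev_separator := hsφ
      norm_point := hy
      apply_point := hyd
      bidual_apply := hφd
      prev_functional_point := hys
      bidual_prev_functional := hφs
      functional_prev := fun i hi => by
        simp only [add_apply, map_add]
        rw [hup i hi, hus i hi, hΨs i hi, add_zero]
      functional_self := by
        simp only [add_apply, map_add]
        rw [huφ, huy, hyd k hkn, hφd k hkn]
      functional_apply := fun i hi => by
        simp only [add_apply]
        rw [hux i hi, add_zero]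
      norm_functional_sub := by rwa [← hk, add_sub_cancel_left] }⟩

end NonnormingDatum

/-! ### Properties of the constructed subspace. -/

variable {𝕜 X : Type*} [RCLike 𝕜] [NormedAddCommGroup X] [NormedSpace 𝕜 X]

variable (𝕜) in
theorem exists_forall_apply_eq_zero_imp_eq_zero {x : ℕ → X} (hx : DenseRange x) :
    ∃ d : ℕ → StrongDual 𝕜 X, ∀ z, (∀ k, d k z = 0) → z = 0 := by
  choose d hd hdx using fun k => exists_dual_vector'' 𝕜 (x k)
  refine ⟨d, fun z hz => norm_le_zero_iff.1 (le_of_forall_pos_le_add fun ε hε => ?_)⟩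
  obtain ⟨k, hk⟩ := hx.exists_dist_lt z (half_pos hε)
  rw [dist_eq_norm] at hk
  have h1 : ‖x k‖ ≤ ‖z - x k‖ := by
    have h2 : d k (z - x k) = -(‖x k‖ : 𝕜) := by rw [map_sub, hz, hdx, zero_sub]
    have h3 := (d k).le_of_opNorm_le (hd k) (z - x k)
    rw [h2, norm_neg, RCLike.norm_ofReal, abs_norm, one_mul] at h3
    exact h3
  have h4 := norm_add_le (z - x k) (x k)
  rw [sub_add_cancel] at h4
  linarith

/-- The dual of a separable Banach space that is not quasireflexive contains a total subspace
that is not norming. -/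
theorem exists_total_nonnorming_of_not_isQuasireflexive [CompleteSpace X]
    [TopologicalSpace.SeparableSpace X] (hX : ¬ IsQuasireflexive 𝕜 X) :
    ∃ (F : Submodule 𝕜 (StrongDual 𝕜 X)) (y : ℕ → X), (∀ z, (∀ f ∈ F, f z = 0) → z = 0) ∧
      (∀ n, ‖y n‖ = 1) ∧ ∀ f ∈ F, ∀ n : ℕ, ‖f (y n)‖ * (n + 1) ≤ ‖f‖ := by
  have hdense := TopologicalSpace.denseRange_denseSeq X
  set x := TopologicalSpace.denseSeq X
  obtain ⟨d, hd⟩ := exists_forall_apply_eq_zero_imp_eq_zero 𝕜 hdense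
  obtain ⟨s, hs⟩ := exists_seq_forall_of_prefix (NonnormingDatum.Admissible d x)
    (fun _ _ _ _ h => .congr h) (NonnormingDatum.exists_admissible hX d x)
  refine ⟨Submodule.span 𝕜 (Set.range fun n => (s n).functional), fun n => (s n).point,
    fun z hz => hd z fun k => ?_, fun n => (hs n).norm_point, fun f hf n => ?_⟩
  · have hC : 0 ≤ ‖NonnormingDatum.correction s (d k) k‖ + 1 := by positivity
    set C := ‖NonnormingDatum.correction s (d k) k‖ + 1
    refine norm_le_zero_iff.1 (le_of_forall_pos_le_add fun ε hε => ?_)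
    obtain ⟨i, hi⟩ := hdense.exists_dist_lt z (show 0 < ε / (C + 1) by positivity)
    rw [dist_eq_norm, lt_div_iff₀ (by positivity)] at hi
    -- Step `Nat.pair k i` is at least `i`, so its functional agrees with `d k` at `x i`, and it
    -- stays within `C` of `d k` whatever `i` is.
    have hm := hs (Nat.pair k i)
    have hh : (s (Nat.pair k i)).functional z = 0 := hz _ (Submodule.subset_span ⟨_, rfl⟩)
    have h1 := hm.functional_apply i (Nat.right_le_pair k i)
    have h2 := hm.norm_functional_sub
    rw [Nat.unpair_pair] at h1 h2
    have h3 := ((s (Nat.pair k i)).functional - d k).le_of_opNorm_le h2 (z - x i)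
    rw [sub_apply, map_sub, map_sub, hh, h1, zero_sub, sub_sub_eq_add_sub, neg_add_cancel,
      zero_sub, norm_neg] at h3
    nlinarith [norm_nonneg (z - x i)]
  · have key : f (s n).point = (s n).bidual f := by
      induction hf using Submodule.span_induction with
      | mem f hf =>
        obtain ⟨m, rfl⟩ := hf
        rcases lt_trichotomy n m with h | rfl | h
        · exact (hs m).functional_prev n h
        · exact (hs n).functional_self
        · exact ((hs n).prev_functional_point m h).trans ((hs n).bidual_prev_functional m h).symm
      | zero => simp
      | add f g _ _ hf hg => rw [add_apply, map_add, hf, hg]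
      | smul c f _ hf => rw [smul_apply, map_smul, hf]
    rw [key]
    have h1 := (s n).bidual.le_opNorm f
    have h2 := (hs n).norm_bidual
    calc ‖(s n).bidual f‖ * (n + 1) ≤ (‖(s n).bidual‖ * ‖f‖) * (n + 1) :=
          mul_le_mul_of_nonneg_right h1 (by positivity)
      _ = (‖(s n).bidual‖ * (n + 1)) * ‖f‖ := by ring
      _ ≤ 1 * ‖f‖ := mul_le_mul_of_nonneg_right h2 (norm_nonneg _)
      _ = ‖f‖ := one_mul _

theorem not_forall_exists_tendsto_of_nonnorming [CompleteSpace X]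
    {F : Set (StrongDual 𝕜 X)} {y : ℕ → X} (hy : ∀ n, ‖y n‖ = 1)
    (hF : ∀ f ∈ F, ∀ n : ℕ, ‖f (y n)‖ * (n + 1) ≤ ‖f‖) :
    ¬ ∀ g : StrongDual 𝕜 X, ∃ f : ℕ → StrongDual 𝕜 X, (∀ n, f n ∈ F) ∧
      ∀ x, Tendsto (fun n => f n x) atTop (𝓝 (g x)) := by
  intro h
  -- Uniform boundedness is used twice: on `X` to bound each sequence `f`, then on `X*` to bound the
  -- vectors `(n+1) • y n`.
  obtain ⟨C, hC⟩ := banach_steinhaus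
    (g := fun n : ℕ => NormedSpace.inclusionInDoubleDual 𝕜 X (((n + 1 : ℕ) : 𝕜) • y n)) fun g => by
      obtain ⟨f, hfF, hf⟩ := h g
      obtain ⟨C, hC⟩ := banach_steinhaus (g := f) fun x => by
        obtain ⟨C, hC⟩ := (hf x).norm.bddAbove_range
        exact ⟨C, fun n => hC ⟨n, rfl⟩⟩
      refine ⟨C, fun n => ?_⟩
      rw [NormedSpace.dual_def, map_smul, norm_smul, RCLike.norm_natCast, mul_comm]
      refine le_of_tendsto ((hf (y n)).norm.mul_const _) (Eventually.of_forall fun m => ?_)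
      have := hF _ (hfF m) n
      push_cast
      exact this.trans (hC m)
  obtain ⟨n, hn⟩ := exists_nat_gt C
  have h1 := hC n
  change ‖NormedSpace.inclusionInDoubleDualLi 𝕜 _‖ ≤ C at h1
  rw [LinearIsometry.norm_map, norm_smul, RCLike.norm_natCast, hy, mul_one] at h1
  push_cast at h1
  linarith

end Nonnorming

theorem theorem3p1 (𝕜 : Type*) [RCLike 𝕜] (X : Type*) [NormedAddCommGroup X]
    [NormedSpace 𝕜 X] [CompleteSpace X] [TopologicalSpace.SeparableSpace X] :
    (∀ F : Submodule 𝕜 (WeakDual 𝕜 X),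
        Dense (F : Set (WeakDual 𝕜 X)) → IsWeakStarSeqDense 𝕜 X (F : Set (WeakDual 𝕜 X))) ↔
      IsQuasireflexive 𝕜 X := by
  constructor
  · intro h
    by_contra hX
    obtain ⟨F, y, htot, hy, hF⟩ := exists_total_nonnorming_of_not_isQuasireflexive hX
    have hseq := h _ (dense_map_toWeakDual_of_total htot)
    refine not_forall_exists_tendsto_of_nonnorming (F := (F : Set (StrongDual 𝕜 X))) hy hF
      fun g => ?_
    obtain ⟨f, hfF, hf⟩ := hseq (StrongDual.toWeakDual g)
    refine ⟨fun n => (f n).toStrongDual, fun n => ?_, hf⟩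
    obtain ⟨f', hf', hff'⟩ := hfF n
    have : f' = (f n).toStrongDual := hff'
    change (f n).toStrongDual ∈ F
    rw [← this]
    exact hf'
  · intro hX F hF g
    let F' : Submodule 𝕜 (StrongDual 𝕜 X) :=
      F.comap (StrongDual.toWeakDual (𝕜 := 𝕜) (E := X)).toLinearMap
    have htot : ∀ x, (∀ f ∈ F', f x = 0) → x = 0 := fun x hx =>
      eq_zero_of_dense_of_forall_apply_eq_zero hF fun f hf => hx f.toStrongDual hf
    obtain ⟨K, hK⟩ := hX.exists_antilipschitz_evalOn htot
    obtain ⟨C, f, hfF, hfC, hf⟩ := exists_bounded_seq_of_antilipschitz_evalOn hK g.toStrongDual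
      (TopologicalSpace.denseSeq X)
    refine ⟨fun n => StrongDual.toWeakDual (f n), hfF, fun x => ?_⟩
    refine tendsto_apply_of_bounded_of_denseRange (TopologicalSpace.denseRange_denseSeq X) hfC
      (fun i => ?_) x
    refine tendsto_const_nhds.congr' ?_
    filter_upwards [eventually_ge_atTop i] with n hn
    exact (hf n i hn).symm
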